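/- **Model.** Fix $T\ge 2$, $q\ge 0$ and a known integer $K\ge 1$ ($K=1$: normal errors; $K\ge 2$: normal-mixture errors). Let $\phi$ be the standard normal density, and for an observation write $w=(y_t,x_t)_{t=1}^T$ with $y_t\in\mathbb R$, $x_t\in\mathbb R^q$. The component density is one of the following. * *Static panel:* $\displaystyle f(w;\theta)=\prod_{t=1}^T\sum_{k=1}^K\tau_k\frac1\sigma\phi\Big(\frac{y_t-\mu_k-x_t^\top\beta}{\sigma}\Big)$, with $\theta=(\tau_1,\dots,\tau_{K-1},\mu_1,\dots,\mu_K,\sigma^2,\beta)$. * *Dynamic panel:* $\displaystyle f(w;\theta)=\sum_{k=1}^K\tau_k\frac1{\sigma_1}\phi\Big(\frac{y_1-\mu_{1,k}-x_1^\top\beta_1}{\sigma_1}\Big)\prod_{t=2}^T\sum_{k=1}^K\tau_k\frac1\sigma\phi\Big(\frac{y_t-\mu_k-\rho y_{t-1}-x_t^\top\beta}{\sigma}\Big)$, with $\theta=(\tau_1,\dots,\tau_{K-1},\mu_{1,1},\dots,\mu_{1,K},\mu_1,\dots,\mu_K,\sigma_1^2,\sigma^2,\beta_1,\beta,\rho)$.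 Here $\tau_K=1-\sum_{k<K}\tau_k$, all $\tau_k\ge0$, and all variances are positive. For $\vartheta_M=(\alpha_1,\dots,\alpha_{M-1},\theta_1,\dots,\theta_M)$, with $\alpha_M=1-\sum_{j<M}\alpha_j$ and all $\alpha_j\ge 0$, put $g_M(w;\vartheta_M)=\sum_{j=1}^M\alpha_jf(w;\theta_j)$. **Data.** Let $M_0\ge1$ and let $\vartheta^*_{M_0}$ be an $M_0$-component parameter. Let $W_i=(Y_{it},X_{it})_{t=1}^T$, $i=1,2,\dots$, be i.i.d., where $Y_i$ has conditional density $g_{M_0}(\cdot\mid x;\vartheta^*_{M_0})$ given $X_i=x$. Let $\mathcal W$ be the support of the law of $W_i$. Assume that for every $j\le M_0$ all $\tau^*_{jk}$ are positive, the means $\mu^*_{jk}$ ($k\le K$) are distinct and, in the dynamic case, the means $\mu^*_{1,jk}$ ($k\le K$) are distinct. Assume that $X$ has finite second moments, and that $\Pr(\exists t:\ X_t^\top\beta\ne X_t^\top\beta_j^*)>0$ for all $j\le M_0$ and all $\beta\neq\beta_j^*$. **Estimator.** Let $M>M_0$ be finite, let $\Theta_M$ be a set of $M$-component parameters (the parameter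 space), and let $c_1,c_2,c_3>0$. Let $\bar\Theta_M(c)$ be the set of $\vartheta_M\in\Theta_M$ such that $\alpha_j\in[c_1,1-c_1]$ for $j<M$, $\sum_{j<M}\alpha_j\le1-c_1$, $\min_j\sigma_j^2\ge c_2\sum_k\alpha_k\sigma_k^2$ and $\sum_k\alpha_k\sigma_k^2\ge c_3$; in the dynamic case the last two conditions are also imposed on the variances $\sigma_{1,j}^2$. Let $$\Theta_M^*=\{\vartheta_M\in\Theta_M:\ g_M(w;\vartheta_M)=g_{M_0}(w;\vartheta^*_{M_0})\ \text{ for all } w\in\mathcal W\}.$$ Assume that $\bar\Theta_M(c)$ is compact and that $\Theta_M^*\cap\bar\Theta_M(c)\ne\emptyset$. For each $n\ge 1$ let $\hat\vartheta_M=\hat\vartheta_{M,n}$ be, almost surely, a maximizer of $\sum_{i=1}^n\log g_M(W_i;\vartheta_M)$ over $\vartheta_M\in\bar\Theta_M(c)$. **Claim.** As $n\to\infty$, $\displaystyle\inf_{\vartheta_M\in\Theta_M^*}\|\hat\vartheta_{M,n}-\vartheta_M\|\to0$ almost surely, where $\|\cdot\|$ is the Euclidean norm. -/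

import Mathlib

open MeasureTheory ProbabilityTheory Filter Topology

noncomputable section

namespace PanelMixture

/-- One cross-sectional observation `w = (y, x)`: outcomes `y_1, …, y_T` (indexed by `0, …, T - 1`)
and covariate vectors `x_1, …, x_T` in `ℝ^q`. -/
abbrev Obs (T q : ℕ) : Type := (Fin T → ℝ) × (Fin T → Fin q → ℝ)

/-- The full weight vector `(a_1, …, a_{n-1}, 1 - ∑ a_i)` given by its first `n - 1` entries. -/
def fullWeights {n : ℕ} (a : Fin (n - 1) → ℝ) : Fin n → ℝ :=
  fun j => if h : (j : ℕ) < n - 1 then a ⟨j, h⟩ else 1 - ∑ i, a i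

/-- The density at `y` of the `K`-component normal mixture with weights `p`, means `m` and common
variance `v`, that is `∑_k p_k (1/σ) φ((y - m_k)/σ)` with `σ² = v`. -/
def normalMixturePDF {K : ℕ} (p m : Fin K → ℝ) (v y : ℝ) : ℝ :=
  ∑ k, p k * gaussianPDFReal (m k) v.toNNReal y

/-- A parametric class of component densities for panels of length `T` with `q` covariates. The two
classes that are used are `staticFamily` and `dynamicFamily` below. -/
structure ComponentFamily (T q : ℕ) where
  /-- the coordinates of the component parameter `θ` -/
  Coord : Type
  [fintypeCoord : Fintype Coord]
  /-- the component density `f(y | x; θ)` -/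
  density : (Coord → ℝ) → Obs T q → ℝ
  /-- the natural restrictions on `θ`: error mixing weights in the simplex, positive variances -/
  natural : Set (Coord → ℝ)
  /-- the coordinates of `θ` that are error variances -/
  varCoords : Set Coord
  /-- all error mixing weights are positive, and the means of the error components are distinct -/
  errorsSeparated : (Coord → ℝ) → Prop
  /-- the slope vector `β` contained in `θ` -/
  slope : (Coord → ℝ) → Fin q → ℝ

attribute [instance] ComponentFamily.fintypeCoord

/-- Coordinates of `θ = (τ_1, …, τ_{K-1}, μ_1, …, μ_K, σ², β)`. -/
inductive StaticCoord (K q : ℕ) : Type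
  | tau (k : Fin (K - 1))
  | mu (k : Fin K)
  | var
  | beta (l : Fin q)
  deriving Fintype

/-- Coordinates of
`θ = (τ_1, …, τ_{K-1}, μ_{1,1}, …, μ_{1,K}, μ_1, …, μ_K, σ_1², σ², β_1, β, ρ)`; the names ending in
`Init` belong to the density of the first period. -/
inductive DynamicCoord (K q : ℕ) : Type
  | tau (k : Fin (K - 1))
  | muInit (k : Fin K)
  | mu (k : Fin K)
  | varInit
  | var
  | betaInit (l : Fin q)
  | beta (l : Fin q)
  | rho
  deriving Fintype

/-- Conditionally independent panel with errors that are mixtures of `K` normals with a common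
variance (`K = 1`: normal errors):
`f(y | x; θ) = ∏_t ∑_k τ_k (1/σ) φ((y_t - μ_k - x_tᵀ β)/σ)`. -/
def staticFamily (K T q : ℕ) : ComponentFamily T q where
  Coord := StaticCoord K q
  density θ w := ∏ t, normalMixturePDF (fullWeights fun k => θ (.tau k))
    (fun k => θ (.mu k) + ∑ l, w.2 t l * θ (.beta l)) (θ .var) (w.1 t)
  natural := {θ | (∀ k : Fin K, 0 ≤ fullWeights (fun k => θ (.tau k)) k) ∧ 0 < θ .var}
  varCoords := {.var}
  errorsSeparated θ := (∀ k : Fin K, 0 < fullWeights (fun k => θ (.tau k)) k) ∧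
    Function.Injective fun k => θ (.mu k)
  slope θ l := θ (.beta l)

/-- Dynamic panel: given the covariates, `y` is a first-order Markov chain with
`f_1(y_1 | x_1; θ) = ∑_k τ_k (1/σ_1) φ((y_1 - μ_{1,k} - x_1ᵀ β_1)/σ_1)` and
`f(y_t | y_{t-1}, x_t; θ) = ∑_k τ_k (1/σ) φ((y_t - μ_k - ρ y_{t-1} - x_tᵀ β)/σ)` for `t ≥ 2`
(`K = 1`: normal errors). -/
def dynamicFamily (K T q : ℕ) : ComponentFamily T q where
  Coord := DynamicCoord K q
  density θ w := ∏ t : Fin T,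
    if (t : ℕ) = 0 then
      normalMixturePDF (fullWeights fun k => θ (.tau k))
        (fun k => θ (.muInit k) + ∑ l, w.2 t l * θ (.betaInit l)) (θ .varInit) (w.1 t)
    else
      normalMixturePDF (fullWeights fun k => θ (.tau k))
        (fun k => θ (.mu k) + θ .rho * w.1 ⟨t - 1, by omega⟩ + ∑ l, w.2 t l * θ (.beta l))
        (θ .var) (w.1 t)
  natural := {θ | (∀ k : Fin K, 0 ≤ fullWeights (fun k => θ (.tau k)) k) ∧
    0 < θ .varInit ∧ 0 < θ .var}
  varCoords := {.varInit, .var}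
  errorsSeparated θ := (∀ k : Fin K, 0 < fullWeights (fun k => θ (.tau k)) k) ∧
    (Function.Injective fun k => θ (.mu k)) ∧ Function.Injective fun k => θ (.muInit k)
  slope θ l := θ (.beta l)

/-- The two kinds of panel models. -/
inductive PanelKind : Type
  | static
  | dynamic

/-- The component densities of a panel model whose errors are `K`-component normal mixtures. -/
def PanelKind.family (kind : PanelKind) (K T q : ℕ) : ComponentFamily T q :=
  match kind with
  | .static => staticFamily K T q
  | .dynamic => dynamicFamily K T q

section Mixture

variable {T q : ℕ} (F : ComponentFamily T q) {M : ℕ}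

/-- The Euclidean space of the parameters `ϑ = (α_1, …, α_{M-1}, θ_1, …, θ_M)`. -/
abbrev Param (M : ℕ) : Type := EuclideanSpace ℝ (Fin (M - 1) ⊕ Fin M × F.Coord)

variable {F}

/-- The mixing weights `α_1, …, α_M` of `ϑ`, with `α_M = 1 - ∑_{j < M} α_j`. -/
def weight (ϑ : Param F M) : Fin M → ℝ := fullWeights fun j => ϑ (.inl j)

/-- The parameter `θ_j` of the `j`-th component. -/
def comp (ϑ : Param F M) (j : Fin M) : F.Coord → ℝ := fun i => ϑ (.inr (j, i))

/-- The mixture density `g_M(w; ϑ) = ∑_j α_j f(w; θ_j)`. -/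
def mixDensity (ϑ : Param F M) (w : Obs T q) : ℝ := ∑ j, weight ϑ j * F.density (comp ϑ j) w

variable (F M)

/-- All admissible parameters of the `M`-component model: mixing weights in the simplex, and every
`θ_j` in the natural component parameter space. -/
def naturalSpace : Set (Param F M) :=
  {ϑ | (∀ j, 0 ≤ weight ϑ j) ∧ ∀ j, comp ϑ j ∈ F.natural}

variable {F M}

/-- The restricted parameter space with constants `c₁, c₂, c₃`: the mixing weights satisfy
`α_j ∈ [c₁, 1 - c₁]` for `j < M` and `∑_{j < M} α_j ≤ 1 - c₁`; and for each kind of error variance,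
`min_j σ_j² ≥ c₂ ∑_k α_k σ_k²` and `∑_k α_k σ_k² ≥ c₃`. -/
def restrictedSpace (Θ : Set (Param F M)) (c₁ c₂ c₃ : ℝ) : Set (Param F M) :=
  {ϑ | ϑ ∈ Θ ∧
    (∀ j : Fin (M - 1), ϑ (.inl j) ∈ Set.Icc c₁ (1 - c₁)) ∧
    ∑ j : Fin (M - 1), ϑ (.inl j) ≤ 1 - c₁ ∧
    ∀ v ∈ F.varCoords,
      (∀ j, c₂ * ∑ k, weight ϑ k * comp ϑ k v ≤ comp ϑ j v) ∧
      c₃ ≤ ∑ k, weight ϑ k * comp ϑ k v}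

/-- The parameters in `Θ` whose `M`-component density equals the density `g` on the set `𝒲`. -/
def reproducing (Θ : Set (Param F M)) (g : Obs T q → ℝ) (𝒲 : Set (Obs T q)) : Set (Param F M) :=
  {ϑ | ϑ ∈ Θ ∧ ∀ w ∈ 𝒲, mixDensity ϑ w = g w}

/-- The log-likelihood `∑_{i < n} log g_M(w_i; ϑ)`. -/
def logLik (n : ℕ) (w : ℕ → Obs T q) (ϑ : Param F M) : ℝ :=
  ∑ i ∈ Finset.range n, Real.log (mixDensity ϑ (w i))

/-- `ϑ` maximizes the log-likelihood of the first `n` observations over the set `S`. -/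
def IsMLE (S : Set (Param F M)) (n : ℕ) (w : ℕ → Obs T q) (ϑ : Param F M) : Prop :=
  ϑ ∈ S ∧ IsMaxOn (logLik n w) S ϑ

/-- The law of `(Y, X)` when `X` has law `ν` and `Y` has conditional density `g_M(· | x; ϑ)` given
`X = x`. -/
def dataLaw (ν : Measure (Fin T → Fin q → ℝ)) (ϑ : Param F M) : Measure (Obs T q) :=
  ((volume : Measure (Fin T → ℝ)).prod ν).withDensity fun w => ENNReal.ofReal (mixDensity ϑ w)

end Mixture

end PanelMixture

end

/-!
The proof is Wald's consistency argument, applied to square roots of likelihood ratios.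

Write `g_ϑ` for the mixture densities and `g*` for the density of the data. Since
`log r ≤ 2 (√r - 1)`, the log-likelihood of `ϑ` minus that of the truth is at most
`2 ∑ (√(g_ϑ / g*) - 1)`. The expectation of `√(g_ϑ / g*)` is the Hellinger affinity of `g_ϑ` and
`g*`, which is less than one unless the two densities agree almost everywhere
(`integral_sqrt_lt_one`); by continuity of the densities, agreement almost everywhere is agreement
on the support of the data, that is, membership of `ϑ` in the reproducing set.

Domination comes from the variance restrictions: they bound `g_ϑ` by a constant `C` on the
restricted space (`mixDensity_le_of_mem_restrictedSpace`), and `√(C / g*)` is integrable because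
`∫ √g* < ∞` (`lintegral_sqrt_mixDensity_lt_top`). The latter needs no moments of the covariates: the
square root of a normal density is a multiple of a normal density with twice the variance, so the
outcomes can be integrated out period by period, uniformly in the covariates. Working with square
roots thus avoids the integrability of `log g*`.

Consequently a uniform law of large numbers (`ae_eventually_forall_sum_neg_of_isCompact`) shows that
on the compact set of restricted parameters at distance at least `ε` from the reproducing set, all
log-likelihoods eventually fall below that of the truth (`ae_eventually_forall_sum_log_lt`). The
restricted space contains a parameter whose likelihood equals that of the truth, so the maximizer
cannot lie in that set.

The static and the dynamic model are treated together: both densities are products over the periods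
of normal mixture densities whose means depend only on earlier outcomes (`SequentialForm`).
-/

noncomputable section

namespace PanelMixture

/-! ### A one-sided uniform law of large numbers -/

section UniformLaw

variable {E X : Type*} [PseudoMetricSpace E] [MeasurableSpace X]

/-- The expectation of the local supremum `sup_{θ near θ₀} f θ` of a dominated family tends to that
of `f θ₀`, so it is negative on some neighbourhood of `θ₀`. -/
theorem exists_nhdsWithin_integrable_bound_integral_neg {Q : Measure X} {A : Set E}
    (hA : TopologicalSpace.IsSeparable A) {f : E → X → ℝ} {B : X → ℝ}
    (hf : ∀ θ ∈ A, Measurable (f θ)) (hcont : ∀ w, ContinuousOn (fun θ => f θ w) A)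
    (hB : Integrable B Q) (hfB : ∀ θ ∈ A, ∀ w, |f θ w| ≤ B w)
    {θ₀ : E} (hθ₀ : θ₀ ∈ A) (hneg : ∫ w, f θ₀ w ∂Q < 0) :
    ∃ U ∈ 𝓝[A] θ₀, ∃ G : X → ℝ, Measurable G ∧ Integrable G Q ∧
      (∀ θ ∈ U, ∀ w, f θ w ≤ G w) ∧ ∫ w, G w ∂Q < 0 := by
  obtain ⟨D, hDA, hDc, hAD⟩ := hA.exists_countable_dense_subset
  let V : ℕ → Set E := fun m => Metric.ball θ₀ (1 / ((m : ℝ) + 1))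
  have hr : ∀ m : ℕ, 0 < 1 / ((m : ℝ) + 1) := fun m => by positivity
  -- `θ₀` is added so that the index set is nonempty and the supremum is at least `f θ₀`
  let S : ℕ → Set E := fun m => insert θ₀ (D ∩ V m)
  have hSA : ∀ m, S m ⊆ A := fun m => Set.insert_subset hθ₀ (Set.inter_subset_left.trans hDA)
  have hSV : ∀ m, S m ⊆ V m := fun m =>
    Set.insert_subset (Metric.mem_ball_self (hr m)) Set.inter_subset_right
  have hSc : ∀ m, Countable (S m) := fun m =>
    ((hDc.mono Set.inter_subset_left).insert θ₀).to_subtype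
  have hSn : ∀ m, Nonempty (S m) := fun m => ⟨⟨θ₀, Set.mem_insert _ _⟩⟩
  let G : ℕ → X → ℝ := fun m w => ⨆ θ : S m, f θ w
  have hbdd : ∀ m w, BddAbove (Set.range fun θ : S m => f θ w) := fun m w =>
    ⟨B w, by rintro _ ⟨θ, rfl⟩; exact (le_abs_self _).trans (hfB _ (hSA m θ.2) w)⟩
  have hGm : ∀ m, Measurable (G m) := fun m => Measurable.iSup fun θ => hf _ (hSA m θ.2)
  have hG₀ : ∀ m w, f θ₀ w ≤ G m w := fun m w =>
    le_ciSup (hbdd m w) ⟨θ₀, Set.mem_insert _ _⟩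
  have hGB : ∀ m w, |G m w| ≤ B w := fun m w => by
    rw [abs_le]
    exact ⟨(neg_le_of_abs_le (hfB _ hθ₀ w)).trans (hG₀ m w),
      ciSup_le fun θ => (le_abs_self _).trans (hfB _ (hSA m θ.2) w)⟩
  have hlim : ∀ w, Tendsto (fun m => G m w) atTop (𝓝 (f θ₀ w)) := fun w => by
    rw [Metric.tendsto_atTop]
    intro ε hε
    obtain ⟨δ, hδ, hδf⟩ := Metric.continuousWithinAt_iff.1 (hcont w θ₀ hθ₀) (ε / 2) (half_pos hε)
    obtain ⟨N, hN⟩ := exists_nat_one_div_lt hδ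
    refine ⟨N, fun m hm => ?_⟩
    have hle : G m w ≤ f θ₀ w + ε / 2 := by
      refine ciSup_le fun θ => ?_
      have h1 : dist (θ : E) θ₀ < δ := by
        have h2 : dist (θ : E) θ₀ < 1 / ((m : ℝ) + 1) := hSV m θ.2
        have h3 : (1 : ℝ) / ((m : ℝ) + 1) ≤ 1 / ((N : ℝ) + 1) := by gcongr
        linarith
      have h4 := hδf (hSA m θ.2) h1
      rw [Real.dist_eq, abs_lt] at h4
      linarith [h4.2]
    rw [Real.dist_eq, abs_lt]
    constructor <;> linarith [hG₀ m w]
  have hint := tendsto_integral_of_dominated_convergence B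
    (fun m => (hGm m).aestronglyMeasurable) hB
    (fun m => Eventually.of_forall fun w => hGB m w) (Eventually.of_forall hlim)
  obtain ⟨m, hm⟩ := (hint.eventually_lt_const hneg).exists
  refine ⟨A ∩ V m, inter_mem_nhdsWithin _ (Metric.ball_mem_nhds _ (hr m)), G m, hGm m,
    hB.mono' (hGm m).aestronglyMeasurable (Eventually.of_forall fun w => hGB m w), ?_, hm⟩
  rintro θ ⟨hθA, hθV⟩ w
  have hcl : θ ∈ closure (D ∩ V m) := by
    rw [Set.inter_comm]
    exact Metric.isOpen_ball.inter_closure ⟨hθV, hAD hθA⟩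
  have hc : ContinuousWithinAt (fun θ => f θ w) (D ∩ V m) θ :=
    (hcont w θ hθA).mono (Set.inter_subset_left.trans hDA)
  have := hc.mem_closure_image hcl
  refine closure_minimal ?_ isClosed_Iic this
  rintro _ ⟨θ', hθ', rfl⟩
  exact le_ciSup (hbdd m w) ⟨θ', Set.mem_insert_of_mem _ hθ'⟩

/-- A uniform law of large numbers in one-sided form: if a dominated family of functions has
negative expectations on a compact set, then almost surely its partial sums along an i.i.d. sample
are eventually negative simultaneously on the whole compact set. -/
theorem ae_eventually_forall_sum_neg_of_isCompact {Ω : Type*} [MeasurableSpace Ω] {P : Measure Ω}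
    {Q : Measure X} {W : ℕ → Ω → X} (hW : ∀ i, Measurable (W i))
    (hindep : iIndepFun W P) (hlaw : ∀ i, P.map (W i) = Q)
    {A : Set E} (hA : IsCompact A) {f : E → X → ℝ} {B : X → ℝ}
    (hf : ∀ θ ∈ A, Measurable (f θ)) (hcont : ∀ w, ContinuousOn (fun θ => f θ w) A)
    (hB : Integrable B Q) (hfB : ∀ θ ∈ A, ∀ w, |f θ w| ≤ B w)
    (hneg : ∀ θ ∈ A, ∫ w, f θ w ∂Q < 0) :
    ∀ᵐ ω ∂P, ∀ᶠ n : ℕ in atTop, ∀ θ ∈ A, ∑ i ∈ Finset.range n, f θ (W i ω) < 0 := by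
  refine hA.induction_on (p := fun s => ∀ᵐ ω ∂P, ∀ᶠ n : ℕ in atTop, ∀ θ ∈ s,
    ∑ i ∈ Finset.range n, f θ (W i ω) < 0) (by simp) ?_ ?_ ?_
  · intro s t hst ht
    filter_upwards [ht] with ω hω
    filter_upwards [hω] with n hn θ hθ using hn θ (hst hθ)
  · intro s t hs ht
    filter_upwards [hs, ht] with ω h1 h2
    filter_upwards [h1, h2] with n h1 h2 θ hθ using hθ.elim (h1 θ) (h2 θ)
  · intro θ₀ hθ₀
    obtain ⟨U, hU, G, hGm, hGi, hfG, hGneg⟩ := exists_nhdsWithin_integrable_bound_integral_neg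
      hA.isSeparable hf hcont hB hfB hθ₀ (hneg θ₀ hθ₀)
    refine ⟨U, hU, ?_⟩
    have h0 : Integrable (fun ω => G (W 0 ω)) P :=
      (integrable_map_measure hGm.aestronglyMeasurable (hW 0).aemeasurable).1
        (by rw [hlaw 0]; exact hGi)
    have hslln := strong_law_ae_real (fun i ω => G (W i ω)) h0
      (fun i j hij => (hindep.indepFun hij).comp hGm hGm)
      (fun i => IdentDistrib.comp
        ⟨(hW i).aemeasurable, (hW 0).aemeasurable, (hlaw i).trans (hlaw 0).symm⟩ hGm)
    have hE : ∫ ω, G (W 0 ω) ∂P < 0 := by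
      rwa [← integral_map (hW 0).aemeasurable hGm.aestronglyMeasurable, hlaw 0]
    filter_upwards [hslln] with ω hω
    filter_upwards [hω.eventually_lt_const hE, eventually_gt_atTop 0] with n hn hn0 θ hθ
    have hn' : (0 : ℝ) < n := by exact_mod_cast hn0
    have hs : ∑ i ∈ Finset.range n, G (W i ω) < 0 := by
      rwa [div_lt_iff₀ hn', zero_mul] at hn
    exact (Finset.sum_le_sum fun i _ => hfG θ hθ _).trans_lt hs

end UniformLaw

/-! ### Likelihood ratios on a compact set of wrong densities -/

section LikelihoodRatio

variable {X : Type*} [MeasurableSpace X]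

/-- The Hellinger affinity of two different distributions is less than one: the square root lies
below its tangent at `1`, and touches it only there. -/
theorem integral_sqrt_lt_one {Q : Measure X} [IsProbabilityMeasure Q] {ρ : X → ℝ}
    (h0 : ∀ w, 0 ≤ ρ w) (hint : Integrable ρ Q) (hle : ∫ w, ρ w ∂Q ≤ 1)
    (hne : ¬ ∀ᵐ w ∂Q, ρ w = 1) : ∫ w, √(ρ w) ∂Q < 1 := by
  have hsq : ∀ w, (ρ w + 1) / 2 - √(ρ w) = (√(ρ w) - 1) ^ 2 / 2 := fun w => by
    have := Real.sq_sqrt (h0 w); ring_nf; linarith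
  have htan : ∀ w, √(ρ w) ≤ (ρ w + 1) / 2 := fun w => by
    have := hsq w; nlinarith [sq_nonneg (√(ρ w) - 1)]
  have hti : Integrable (fun w => (ρ w + 1) / 2) Q := (hint.add (integrable_const 1)).div_const 2
  have hsi : Integrable (fun w => √(ρ w)) Q :=
    hti.mono' (Real.continuous_sqrt.comp_aestronglyMeasurable hint.1)
      (Eventually.of_forall fun w => by
        rw [Real.norm_of_nonneg (Real.sqrt_nonneg _)]; exact htan w)
  have htI : ∫ w, (ρ w + 1) / 2 ∂Q ≤ 1 := by
    rw [integral_div, integral_add hint (integrable_const 1)]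
    simp only [integral_const, probReal_univ, smul_eq_mul, mul_one]
    linarith
  by_contra! hcon
  refine hne ?_
  have hz : ∫ w, ((ρ w + 1) / 2 - √(ρ w)) ∂Q = 0 := by
    refine le_antisymm ?_ (integral_nonneg fun w => sub_nonneg.2 (htan w))
    rw [integral_sub hti hsi]
    linarith
  rw [integral_eq_zero_iff_of_nonneg (fun w => sub_nonneg.2 (htan w)) (hti.sub hsi)] at hz
  filter_upwards [hz] with w hw
  rw [hsq, Pi.zero_apply] at hw
  have h1 : √(ρ w) = 1 := by
    have : (√(ρ w) - 1) ^ 2 = 0 := by linarith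
    linarith [pow_eq_zero_iff (two_ne_zero) |>.1 this]
  have := Real.sq_sqrt (h0 w)
  rw [h1] at this
  linarith

/-- Change of measure from the density `g₀` to the dominating measure. -/
theorem lintegral_ofReal_div_withDensity {μ : Measure X} {g₀ h : X → ℝ} (hg₀ : Measurable g₀)
    (hpos : ∀ w, 0 < g₀ w) (hh : Measurable h) :
    ∫⁻ w, ENNReal.ofReal (h w / g₀ w) ∂μ.withDensity (fun w => ENNReal.ofReal (g₀ w)) =
      ∫⁻ w, ENNReal.ofReal (h w) ∂μ := by
  rw [lintegral_withDensity_eq_lintegral_mul (g := fun w => ENNReal.ofReal (h w / g₀ w)) _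
    hg₀.ennreal_ofReal (hh.div hg₀).ennreal_ofReal]
  refine lintegral_congr fun w => ?_
  rw [Pi.mul_apply, ← ENNReal.ofReal_mul (hpos w).le, mul_div_cancel₀ _ (hpos w).ne']

/-- Wald's argument. If no density in the compact family `A` coincides with the density `g₀` of
the sample, then almost surely every member of `A` eventually has a smaller likelihood than `g₀`.
As `log r ≤ 2 (√r - 1)`, it suffices to consider the square roots of the likelihood ratios, whose
expectations are less than one and which are dominated by the integrable function `√(C / g₀)`. -/
theorem ae_eventually_forall_sum_log_lt {E : Type*} [PseudoMetricSpace E]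
    {μ : Measure X} {g₀ : X → ℝ} (hg₀ : Measurable g₀) (hg₀pos : ∀ w, 0 < g₀ w)
    (hsqrt : ∫⁻ w, ENNReal.ofReal √(g₀ w) ∂μ < ⊤)
    {Ω : Type*} [MeasurableSpace Ω] {P : Measure Ω} [IsProbabilityMeasure P]
    {W : ℕ → Ω → X} (hW : ∀ i, Measurable (W i)) (hindep : iIndepFun W P)
    (hlaw : ∀ i, P.map (W i) = μ.withDensity fun w => ENNReal.ofReal (g₀ w))
    {A : Set E} (hA : IsCompact A) {g : E → X → ℝ} {C : ℝ}
    (hg : ∀ θ ∈ A, Measurable (g θ)) (hcont : ∀ w, ContinuousOn (fun θ => g θ w) A)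
    (hpos : ∀ θ ∈ A, ∀ w, 0 < g θ w) (hC : ∀ θ ∈ A, ∀ w, g θ w ≤ C)
    (hone : ∀ θ ∈ A, ∫⁻ w, ENNReal.ofReal (g θ w) ∂μ ≤ 1)
    (hne : ∀ θ ∈ A, ¬ ∀ᵐ w ∂μ.withDensity (fun w => ENNReal.ofReal (g₀ w)), g θ w = g₀ w) :
    ∀ᵐ ω ∂P, ∀ᶠ n : ℕ in atTop, ∀ θ ∈ A,
      ∑ i ∈ Finset.range n, Real.log (g θ (W i ω)) <
        ∑ i ∈ Finset.range n, Real.log (g₀ (W i ω)) := by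
  set Q := μ.withDensity fun w => ENNReal.ofReal (g₀ w) with hQ
  have : IsProbabilityMeasure Q := hlaw 0 ▸ Measure.isProbabilityMeasure_map (hW 0).aemeasurable
  have henv : Integrable (fun w => √(C / g₀ w)) Q := by
    refine ⟨(hg₀.const_div C).sqrt.aestronglyMeasurable, ?_⟩
    rw [hasFiniteIntegral_iff_ofReal (Eventually.of_forall fun w => Real.sqrt_nonneg _)]
    have h1 : ∀ w, √(C / g₀ w) = (√C * √(g₀ w)) / g₀ w := fun w => by
      rw [Real.sqrt_div' _ (hg₀pos w).le, mul_div_assoc, Real.sqrt_div_self', mul_one_div]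
    simp_rw [h1]
    rw [lintegral_ofReal_div_withDensity hg₀ hg₀pos (hg₀.sqrt.const_mul _)]
    simp_rw [ENNReal.ofReal_mul (Real.sqrt_nonneg C)]
    rw [lintegral_const_mul' _ _ ENNReal.ofReal_ne_top]
    exact ENNReal.mul_lt_top ENNReal.ofReal_lt_top hsqrt
  have hlt : ∀ θ ∈ A, ∫ w, √(g θ w / g₀ w) ∂Q < 1 := fun θ hθ => by
    have h0 : ∀ w, 0 ≤ g θ w / g₀ w := fun w => (div_pos (hpos θ hθ w) (hg₀pos w)).le
    have hl : ∫⁻ w, ENNReal.ofReal (g θ w / g₀ w) ∂Q ≤ 1 := by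
      rw [lintegral_ofReal_div_withDensity hg₀ hg₀pos (hg θ hθ)]
      exact hone θ hθ
    have hm : AEStronglyMeasurable (fun w => g θ w / g₀ w) Q :=
      ((hg θ hθ).div hg₀).aestronglyMeasurable
    refine integral_sqrt_lt_one h0 ⟨hm, ?_⟩ ?_ ?_
    · rw [hasFiniteIntegral_iff_ofReal (Eventually.of_forall h0)]
      exact hl.trans_lt ENNReal.one_lt_top
    · rw [integral_eq_lintegral_of_nonneg_ae (Eventually.of_forall h0) hm]
      exact ENNReal.toReal_le_of_le_ofReal zero_le_one (by simpa using hl)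
    · refine fun h => hne θ hθ ?_
      filter_upwards [h] with w hw
      rwa [div_eq_one_iff_eq (hg₀pos w).ne'] at hw
  have hdom : ∀ θ ∈ A, ∀ w, √(g θ w / g₀ w) ≤ √(C / g₀ w) := fun θ hθ w =>
    Real.sqrt_le_sqrt (div_le_div_of_nonneg_right (hC θ hθ w) (hg₀pos w).le)
  have hmeas : ∀ θ ∈ A, Measurable fun w => √(g θ w / g₀ w) := fun θ hθ =>
    ((hg θ hθ).div hg₀).sqrt
  have key := ae_eventually_forall_sum_neg_of_isCompact hW hindep hlaw hA
    (f := fun θ w => √(g θ w / g₀ w) - 1) (B := fun w => √(C / g₀ w) + 1)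
    (fun θ hθ => (hmeas θ hθ).sub_const 1)
    (fun w => ((hcont w).div_const _).sqrt.sub continuousOn_const)
    (henv.add (integrable_const 1))
    (fun θ hθ w => by
      have := Real.sqrt_nonneg (g θ w / g₀ w)
      have := hdom θ hθ w
      rw [abs_le]; constructor <;> linarith)
    (fun θ hθ => by
      have hi : Integrable (fun w => √(g θ w / g₀ w)) Q :=
        henv.mono' (hmeas θ hθ).aestronglyMeasurable (Eventually.of_forall fun w => by
          rw [Real.norm_of_nonneg (Real.sqrt_nonneg _)]; exact hdom θ hθ w)
      rw [integral_sub hi (integrable_const 1)]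
      simpa using hlt θ hθ)
  filter_upwards [key] with ω hω
  filter_upwards [hω] with n hn θ hθ
  have hlog : ∀ w, Real.log (g θ w) - Real.log (g₀ w) ≤ 2 * (√(g θ w / g₀ w) - 1) := fun w => by
    have hp := div_pos (hpos θ hθ w) (hg₀pos w)
    rw [← Real.log_div (hpos θ hθ w).ne' (hg₀pos w).ne']
    have := Real.log_le_sub_one_of_pos (Real.sqrt_pos.2 hp)
    rw [Real.log_sqrt hp.le] at this
    linarith
  rw [← sub_neg, ← Finset.sum_sub_distrib]
  refine (Finset.sum_le_sum fun i _ => hlog _).trans_lt ?_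
  rw [← Finset.mul_sum]
  linarith [hn θ hθ]

end LikelihoodRatio

/-! ### Normal mixture densities -/

theorem sum_fullWeights {n : ℕ} (hn : 1 ≤ n) (a : Fin (n - 1) → ℝ) :
    ∑ j : Fin n, fullWeights a j = 1 := by
  obtain ⟨m, rfl⟩ : ∃ m, n = m + 1 := ⟨n - 1, by omega⟩
  rw [Fin.sum_univ_castSucc]
  have h1 : ∀ i : Fin m, fullWeights (n := m + 1) a i.castSucc = a i := fun i =>
    dif_pos (show (i.castSucc : ℕ) < m + 1 - 1 from i.2)
  have h2 : fullWeights (n := m + 1) a (Fin.last m) = 1 - ∑ i, a i :=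
    dif_neg (show ¬ ((Fin.last m : Fin (m + 1)) : ℕ) < m + 1 - 1 by simp)
  rw [h2, Finset.sum_congr rfl fun i _ => h1 i]
  exact add_sub_cancel _ _

theorem continuous_fullWeights {n : ℕ} (j : Fin n) :
    Continuous fun a : Fin (n - 1) → ℝ => fullWeights a j := by
  unfold fullWeights
  split_ifs <;> fun_prop

theorem gaussianPDFReal_le {c v : ℝ} (hc : 0 < c) (hv : c ≤ v) (m y : ℝ) :
    gaussianPDFReal m v.toNNReal y ≤ (√(2 * Real.pi * c))⁻¹ := by
  rw [gaussianPDFReal, Real.coe_toNNReal _ (hc.le.trans hv)]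
  have h1 : Real.exp (-(y - m) ^ 2 / (2 * v)) ≤ 1 := by
    rw [Real.exp_le_one_iff]
    exact div_nonpos_of_nonpos_of_nonneg (by nlinarith [sq_nonneg (y - m)]) (by linarith)
  have h2 : (√(2 * Real.pi * v))⁻¹ ≤ (√(2 * Real.pi * c))⁻¹ := by
    have := Real.pi_pos
    gcongr
  calc _ ≤ (√(2 * Real.pi * c))⁻¹ * 1 := by gcongr
    _ = _ := mul_one _

/-- The square root of a normal density is proportional to the normal density with the same mean
and twice the variance. -/
theorem exists_sqrt_gaussianPDFReal_eq {v : ℝ} (hv : 0 < v) :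
    ∃ C, 0 ≤ C ∧ ∀ m y, √(gaussianPDFReal m v.toNNReal y) =
      C * gaussianPDFReal m (2 * v).toNNReal y := by
  have hpi := Real.pi_pos
  refine ⟨√((√(2 * Real.pi * v))⁻¹) * √(2 * Real.pi * (2 * v)), by positivity, fun m y => ?_⟩
  rw [gaussianPDFReal, gaussianPDFReal, Real.coe_toNNReal _ hv.le,
    Real.coe_toNNReal _ (by positivity), Real.sqrt_mul (inv_nonneg.2 (Real.sqrt_nonneg _)),
    ← Real.exp_half]
  have h : √(2 * Real.pi * (2 * v)) ≠ 0 := by positivity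
  have he : -(y - m) ^ 2 / (2 * v) / 2 = -(y - m) ^ 2 / (2 * (2 * v)) := by
    field_simp
  rw [he, mul_assoc (√((√(2 * Real.pi * v))⁻¹)), mul_inv_cancel_left₀ h]

section NormalMixture

variable {K : ℕ} {p m : Fin K → ℝ} {v : ℝ}

theorem normalMixturePDF_nonneg (hp : ∀ k, 0 ≤ p k) (y : ℝ) : 0 ≤ normalMixturePDF p m v y :=
  Finset.sum_nonneg fun k _ => mul_nonneg (hp k) (gaussianPDFReal_nonneg _ _ _)

theorem normalMixturePDF_pos (hp : ∀ k, 0 ≤ p k) (hsum : ∑ k, p k = 1) (hv : 0 < v) (y : ℝ) :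
    0 < normalMixturePDF p m v y := by
  obtain ⟨k, -, hk⟩ : ∃ k ∈ Finset.univ, 0 < p k := by
    by_contra! h
    linarith [Finset.sum_nonpos h]
  exact Finset.sum_pos' (fun k _ => mul_nonneg (hp k) (gaussianPDFReal_nonneg _ _ _))
    ⟨k, Finset.mem_univ _, mul_pos hk (gaussianPDFReal_pos _ _ _ (Real.toNNReal_pos.2 hv).ne')⟩

theorem normalMixturePDF_le (hp : ∀ k, 0 ≤ p k) (hsum : ∑ k, p k = 1) {c : ℝ} (hc : 0 < c)
    (hv : c ≤ v) (y : ℝ) : normalMixturePDF p m v y ≤ (√(2 * Real.pi * c))⁻¹ := by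
  refine (Finset.sum_le_sum fun k _ =>
    mul_le_mul_of_nonneg_left (gaussianPDFReal_le hc hv (m k) y) (hp k)).trans_eq ?_
  rw [← Finset.sum_mul, hsum, one_mul]

theorem lintegral_normalMixturePDF (hp : ∀ k, 0 ≤ p k) (hsum : ∑ k, p k = 1) (hv : 0 < v) :
    ∫⁻ y, ENNReal.ofReal (normalMixturePDF p m v y) = 1 := by
  unfold normalMixturePDF
  simp_rw [ENNReal.ofReal_sum_of_nonneg fun k _ =>
    mul_nonneg (hp k) (gaussianPDFReal_nonneg (m k) v.toNNReal _), ENNReal.ofReal_mul (hp _)]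
  rw [lintegral_finsetSum _ fun k _ => by fun_prop]
  simp_rw [lintegral_const_mul' _ _ ENNReal.ofReal_ne_top,
    lintegral_gaussianPDFReal_eq_one _ (Real.toNNReal_pos.2 hv).ne', mul_one]
  rw [← ENNReal.ofReal_sum_of_nonneg fun k _ => hp k, hsum, ENNReal.ofReal_one]

theorem sqrt_sum_le_sum_sqrt {ι : Type*} (s : Finset ι) {a : ι → ℝ} (ha : ∀ i ∈ s, 0 ≤ a i) :
    √(∑ i ∈ s, a i) ≤ ∑ i ∈ s, √(a i) := by
  rw [Real.sqrt_le_left (Finset.sum_nonneg fun i _ => Real.sqrt_nonneg _)]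
  calc ∑ i ∈ s, a i = ∑ i ∈ s, √(a i) ^ 2 :=
        Finset.sum_congr rfl fun i hi => (Real.sq_sqrt (ha i hi)).symm
    _ ≤ _ := Finset.sum_sq_le_sq_sum_of_nonneg fun i _ => Real.sqrt_nonneg _

/-- The bound is uniform in the weights and the means; this is what makes `∫ √f` bounded uniformly
in the covariates. -/
theorem exists_lintegral_sqrt_normalMixturePDF_le (K : ℕ) (hv : 0 < v) :
    ∃ C : ENNReal, C ≠ ⊤ ∧ ∀ p m : Fin K → ℝ, (∀ k, 0 ≤ p k) → ∑ k, p k = 1 →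
      ∫⁻ y, ENNReal.ofReal √(normalMixturePDF p m v y) ≤ C := by
  obtain ⟨C, hC, hsqrt⟩ := exists_sqrt_gaussianPDFReal_eq hv
  refine ⟨K * ENNReal.ofReal C,
    ENNReal.mul_ne_top (ENNReal.natCast_ne_top K) ENNReal.ofReal_ne_top, fun p m hp hsum => ?_⟩
  have hp1 : ∀ k, p k ≤ 1 := fun k =>
    hsum ▸ Finset.single_le_sum (fun k _ => hp k) (Finset.mem_univ k)
  have hle : ∀ y, ENNReal.ofReal √(normalMixturePDF p m v y) ≤
      ∑ k, ENNReal.ofReal C * ENNReal.ofReal (gaussianPDFReal (m k) (2 * v).toNNReal y) := by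
    intro y
    simp_rw [← ENNReal.ofReal_mul hC]
    rw [← ENNReal.ofReal_sum_of_nonneg
      fun k _ => mul_nonneg hC (gaussianPDFReal_nonneg _ _ _)]
    refine ENNReal.ofReal_le_ofReal ((sqrt_sum_le_sum_sqrt _ fun k _ =>
      mul_nonneg (hp k) (gaussianPDFReal_nonneg _ _ _)).trans (Finset.sum_le_sum fun k _ => ?_))
    rw [← hsqrt]
    exact Real.sqrt_le_sqrt (mul_le_of_le_one_left (gaussianPDFReal_nonneg _ _ _) (hp1 k))
  refine (lintegral_mono hle).trans_eq ?_
  rw [lintegral_finsetSum _ fun k _ => by fun_prop]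
  simp_rw [lintegral_const_mul' _ _ ENNReal.ofReal_ne_top,
    lintegral_gaussianPDFReal_eq_one _ (Real.toNNReal_pos.2 (show 0 < 2 * v by positivity)).ne']
  simp

theorem continuousOn_normalMixturePDF {Z : Type*} [TopologicalSpace Z] {s : Set Z}
    {p m : Z → Fin K → ℝ} {v y : Z → ℝ} (hp : ∀ k, ContinuousOn (fun z => p z k) s)
    (hm : ∀ k, ContinuousOn (fun z => m z k) s) (hv : ContinuousOn v s) (hy : ContinuousOn y s)
    (hpos : ∀ z ∈ s, 0 < v z) :
    ContinuousOn (fun z => normalMixturePDF (p z) (m z) (v z) (y z)) s := by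
  have hpi := Real.pi_pos
  have hv' : ContinuousOn (fun z => ((v z).toNNReal : ℝ)) s :=
    hv.congr fun z hz => Real.coe_toNNReal _ (hpos z hz).le
  have hp' : ∀ z ∈ s, (0 : ℝ) < ((v z).toNNReal : ℝ) := fun z hz => by simpa using hpos z hz
  refine continuousOn_finsetSum _ fun k _ => (hp k).mul ?_
  unfold gaussianPDFReal
  refine ContinuousOn.mul (ContinuousOn.inv₀ (continuousOn_const.mul hv').sqrt fun z hz => ?_)
    (Real.continuous_exp.comp_continuousOn
      (((hy.sub (hm k)).pow 2).neg.div (continuousOn_const.mul hv') fun z hz => ?_))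
  · have := hp' z hz; positivity
  · have := hp' z hz; positivity

end NormalMixture

/-! ### Products of conditional densities -/

/-- Integrating out the coordinates one after the other, the last one first: if the `t`-th factor
depends only on the coordinates up to `t`, and its integral over coordinate `t` is at most `C t`,
then the integral of the product is at most `∏ t, C t`. -/
theorem lintegral_prod_le_of_causal {n : ℕ} (F : Fin n → (Fin n → ℝ) → ENNReal)
    (C : Fin n → ENNReal) (hF : ∀ t, Measurable (F t))
    (hcausal : ∀ t y y', (∀ s ≤ t, y s = y' s) → F t y = F t y')
    (hint : ∀ t y, ∫⁻ u, F t (Function.update y t u) ≤ C t) :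
    ∫⁻ y, ∏ t, F t y ≤ ∏ t, C t := by
  induction n with
  | zero => simp [volume_pi]
  | succ n ih =>
    have hmp := (volume_preserving_piFinSuccAbove (fun _ : Fin (n + 1) => ℝ) (Fin.last n)).symm
    have he : ∀ (u : ℝ) (y : Fin n → ℝ),
        (MeasurableEquiv.piFinSuccAbove (fun _ : Fin (n + 1) => ℝ) (Fin.last n)).symm (u, y) =
          (Fin.snoc y u : Fin (n + 1) → ℝ) := fun u y => by
      simp [MeasurableEquiv.piFinSuccAbove, Fin.insertNthEquiv, Fin.insertNth_last']
    have hsnoc : Measurable fun z : ℝ × (Fin n → ℝ) => (Fin.snoc z.2 z.1 : Fin (n + 1) → ℝ) := by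
      simp_rw [← he]
      exact MeasurableEquiv.measurable _
    have hsnoc0 : Measurable fun y : Fin n → ℝ => (Fin.snoc y 0 : Fin (n + 1) → ℝ) :=
      hsnoc.comp (measurable_const.prodMk measurable_id)
    have hmeas : Measurable fun y => ∏ t, F t y := Finset.measurable_prod _ fun t _ => hF t
    let F' : Fin n → (Fin n → ℝ) → ENNReal := fun t y =>
      F t.castSucc (Fin.snoc y 0 : Fin (n + 1) → ℝ)
    have hF' : ∀ (t : Fin n) (y : Fin n → ℝ) (u : ℝ),
        F t.castSucc (Fin.snoc y u : Fin (n + 1) → ℝ) = F' t y := fun t y u => by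
      refine hcausal _ _ _ fun s hs => ?_
      obtain ⟨s', rfl⟩ : ∃ s', s = Fin.castSucc s' :=
        ⟨s.castLT (lt_of_le_of_lt hs t.2), rfl⟩
      simp
    have ih' := ih F' (fun t => C t.castSucc) (fun t => (hF _).comp hsnoc0)
      (fun t y y' h => by
        refine hcausal _ _ _ fun s hs => ?_
        obtain ⟨s', rfl⟩ : ∃ s', s = Fin.castSucc s' :=
          ⟨s.castLT (lt_of_le_of_lt hs t.2), rfl⟩
        simpa using h s' (by simpa using hs))
      (fun t y => by
        refine le_trans (le_of_eq (lintegral_congr fun u => ?_))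
          (hint t.castSucc (Fin.snoc y 0 : Fin (n + 1) → ℝ))
        simp only [F']
        rw [Fin.snoc_update])
    have hlast : ∀ y : Fin n → ℝ,
        ∫⁻ u, F (Fin.last n) (Fin.snoc y u : Fin (n + 1) → ℝ) ≤ C (Fin.last n) := fun y => by
      refine le_trans (le_of_eq (lintegral_congr fun u => ?_))
        (hint (Fin.last n) (Fin.snoc y 0 : Fin (n + 1) → ℝ))
      rw [Fin.update_snoc_last]
    rw [← hmp.lintegral_comp hmeas, Measure.volume_eq_prod, lintegral_prod_symm'
      (fun z => ∏ t, F t _) (hmeas.comp (MeasurableEquiv.measurable _))]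
    simp_rw [he, Fin.prod_univ_castSucc, hF']
    calc ∫⁻ y : Fin n → ℝ, ∫⁻ u, (∏ t, F' t y) * F (Fin.last n) (Fin.snoc y u : Fin (n + 1) → ℝ)
        ≤ ∫⁻ y : Fin n → ℝ, (∏ t, F' t y) * C (Fin.last n) := by
          refine lintegral_mono fun y => ?_
          have hm : Measurable fun u => F (Fin.last n) (Fin.snoc y u : Fin (n + 1) → ℝ) :=
            (hF _).comp (hsnoc.comp (measurable_id.prodMk measurable_const))
          rw [lintegral_const_mul _ hm]
          exact mul_le_mul_right (hlast y) _
      _ = (∫⁻ y : Fin n → ℝ, ∏ t, F' t y) * C (Fin.last n) :=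
          lintegral_mul_const _ (Finset.measurable_prod _ fun t _ => (hF _).comp hsnoc0)
      _ ≤ _ := mul_le_mul_left ih' _

/-- A presentation of a parametric class of component densities as a product over the periods of
conditional normal mixture densities. The common variance in period `t` is a coordinate of `θ`, and
the means may depend on the covariates and on the outcomes of earlier periods. -/
structure SequentialForm {T q : ℕ} (F : ComponentFamily T q) (K : ℕ) where
  /-- the weights of the error components -/
  prob : (F.Coord → ℝ) → Fin K → ℝ
  /-- the conditional means of the error components -/
  loc : (F.Coord → ℝ) → Obs T q → Fin T → Fin K → ℝ
  /-- the coordinate holding the error variance of a period -/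
  scale : Fin T → F.Coord
  density_eq : ∀ θ w, F.density θ w =
    ∏ t, normalMixturePDF (prob θ) (loc θ w t) (θ (scale t)) (w.1 t)
  scale_mem : ∀ t, scale t ∈ F.varCoords
  prob_nonneg : ∀ θ ∈ F.natural, ∀ k, 0 ≤ prob θ k
  sum_prob : ∀ θ, ∑ k, prob θ k = 1
  scale_pos : ∀ θ ∈ F.natural, ∀ t, 0 < θ (scale t)
  continuous_prob : ∀ k, Continuous fun θ => prob θ k
  continuous_loc : ∀ t k, Continuous fun z : (F.Coord → ℝ) × Obs T q => loc z.1 z.2 t k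
  loc_congr : ∀ θ x t (y y' : Fin T → ℝ), (∀ s < t, y s = y' s) →
    loc θ (y, x) t = loc θ (y', x) t

/-- The static panel density in sequential form. -/
def staticForm {K : ℕ} (hK : 1 ≤ K) (T q : ℕ) : SequentialForm (staticFamily K T q) K where
  prob θ := fullWeights fun k => θ (.tau k)
  loc θ w t := fun k => θ (.mu k) + ∑ l, w.2 t l * θ (.beta l)
  scale _ := .var
  density_eq _ _ := rfl
  scale_mem _ := rfl
  prob_nonneg _ hθ := hθ.1
  sum_prob _ := sum_fullWeights hK _
  scale_pos _ hθ _ := hθ.2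
  continuous_prob k := (continuous_fullWeights k).comp (by fun_prop)
  continuous_loc t k := by dsimp only [staticFamily]; fun_prop
  loc_congr _ _ _ _ _ _ := rfl

/-- The dynamic panel density in sequential form. -/
def dynamicForm {K : ℕ} (hK : 1 ≤ K) (T q : ℕ) : SequentialForm (dynamicFamily K T q) K where
  prob θ := fullWeights fun k => θ (.tau k)
  loc θ w t := if (t : ℕ) = 0 then
      fun k => θ (.muInit k) + ∑ l, w.2 t l * θ (.betaInit l)
    else
      fun k => θ (.mu k) + θ .rho * w.1 ⟨t - 1, by omega⟩ + ∑ l, w.2 t l * θ (.beta l)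
  scale t := if (t : ℕ) = 0 then .varInit else .var
  density_eq θ w := by
    dsimp only [dynamicFamily]
    refine Finset.prod_congr rfl fun t _ => ?_
    by_cases h : (t : ℕ) = 0 <;> simp [h]
  scale_mem t := by
    by_cases h : (t : ℕ) = 0 
    · exact Or.inl (if_pos h)
    · exact Or.inr (if_neg h)
  prob_nonneg _ hθ := hθ.1
  sum_prob _ := sum_fullWeights hK _
  scale_pos θ hθ t := by
    by_cases h : (t : ℕ) = 0
    · simpa [h] using hθ.2.1
    · simpa [h] using hθ.2.2
  continuous_prob k := (continuous_fullWeights k).comp (by fun_prop)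
  continuous_loc t k := by
    dsimp only [dynamicFamily]
    split_ifs <;> fun_prop
  loc_congr θ x t y y' h := by
    split_ifs with h0
    · rfl
    · have := h ⟨t - 1, by omega⟩ (Fin.lt_def.2 (by simp; omega))
      simp only [this]

/-- The sequential form of either panel model. -/
def PanelKind.form (kind : PanelKind) {K : ℕ} (hK : 1 ≤ K) (T q : ℕ) :
    SequentialForm (kind.family K T q) K :=
  match kind with
  | .static => staticForm hK T q
  | .dynamic => dynamicForm hK T q

namespace SequentialForm

variable {T q K : ℕ} {F : ComponentFamily T q} {θ : F.Coord → ℝ}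

theorem density_pos (S : SequentialForm F K) (hθ : θ ∈ F.natural) (w : Obs T q) :
    0 < F.density θ w := by
  rw [S.density_eq]
  exact Finset.prod_pos fun t _ =>
    normalMixturePDF_pos (S.prob_nonneg θ hθ) (S.sum_prob θ) (S.scale_pos θ hθ t) _

theorem density_le (S : SequentialForm F K) (hθ : θ ∈ F.natural) {c : ℝ} (hc : 0 < c)
    (hvar : ∀ v ∈ F.varCoords, c ≤ θ v) (w : Obs T q) :
    F.density θ w ≤ ((√(2 * Real.pi * c))⁻¹) ^ T := by
  rw [S.density_eq]
  refine (Finset.prod_le_prod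
    (fun t _ => normalMixturePDF_nonneg (S.prob_nonneg θ hθ) _) fun t _ =>
    normalMixturePDF_le (S.prob_nonneg θ hθ) (S.sum_prob θ) hc
      (hvar _ (S.scale_mem t)) _).trans_eq ?_
  simp

theorem continuousOn_density (S : SequentialForm F K) :
    ContinuousOn (fun z : (F.Coord → ℝ) × Obs T q => F.density z.1 z.2)
      (F.natural ×ˢ Set.univ) := by
  simp_rw [S.density_eq]
  exact continuousOn_finsetProd _ fun t _ => continuousOn_normalMixturePDF
    (fun k => ((S.continuous_prob k).comp continuous_fst).continuousOn)
    (fun k => (S.continuous_loc t k).continuousOn) (by fun_prop) (by fun_prop)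
    fun z hz => S.scale_pos _ hz.1 t

theorem continuous_density (S : SequentialForm F K) (hθ : θ ∈ F.natural) :
    Continuous (F.density θ) := by
  rw [← continuousOn_univ]
  exact S.continuousOn_density.comp (f := fun w => (θ, w)) (by fun_prop) fun w _ => ⟨hθ, trivial⟩

/-- The integral over the outcomes of a function of the conditional densities of the periods is
controlled one period at a time. -/
theorem lintegral_prod_normalMixturePDF_le (S : SequentialForm F K) (hθ : θ ∈ F.natural)
    (φ : ℝ → ENNReal) (hφ : Measurable φ) (C : Fin T → ENNReal)
    (hC : ∀ t (m : Fin K → ℝ),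
      ∫⁻ u, φ (normalMixturePDF (S.prob θ) m (θ (S.scale t)) u) ≤ C t)
    (x : Fin T → Fin q → ℝ) :
    ∫⁻ y : Fin T → ℝ, ∏ t, φ (normalMixturePDF (S.prob θ) (S.loc θ (y, x) t)
      (θ (S.scale t)) (y t)) ≤ ∏ t, C t := by
  refine lintegral_prod_le_of_causal (fun t y => φ (normalMixturePDF (S.prob θ)
    (S.loc θ (y, x) t) (θ (S.scale t)) (y t))) C (fun t => hφ.comp (Continuous.measurable ?_))
    (fun t y y' h => ?_) fun t y => ?_
  · rw [← continuousOn_univ]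
    refine continuousOn_normalMixturePDF (fun k => continuousOn_const) (fun k => ?_)
      continuousOn_const (by fun_prop) fun _ _ => S.scale_pos θ hθ t
    exact ((S.continuous_loc t k).comp (f := fun y : Fin T → ℝ => (θ, (y, x)))
      (by fun_prop)).continuousOn
  · rw [S.loc_congr θ x t y y' fun s hs => h s hs.le, h t le_rfl]
  · refine le_trans (le_of_eq (lintegral_congr fun u => ?_)) (hC t (S.loc θ (y, x) t))
    rw [S.loc_congr θ x t (Function.update y t u) y fun s hs => Function.update_of_ne hs.ne _ _,
      Function.update_self]

theorem lintegral_density_le_one (S : SequentialForm F K) (hθ : θ ∈ F.natural)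
    (x : Fin T → Fin q → ℝ) : ∫⁻ y, ENNReal.ofReal (F.density θ (y, x)) ≤ 1 := by
  simp_rw [S.density_eq, ENNReal.ofReal_prod_of_nonneg
    fun t _ => normalMixturePDF_nonneg (S.prob_nonneg θ hθ) _]
  refine (S.lintegral_prod_normalMixturePDF_le hθ _ ENNReal.measurable_ofReal (fun _ => 1)
    (fun t m => (lintegral_normalMixturePDF (S.prob_nonneg θ hθ) (S.sum_prob θ)
      (S.scale_pos θ hθ t)).le) x).trans_eq (by simp)

theorem exists_lintegral_sqrt_density_le (S : SequentialForm F K) (hθ : θ ∈ F.natural) :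
    ∃ C : ENNReal, C ≠ ⊤ ∧
      ∀ x : Fin T → Fin q → ℝ, ∫⁻ y, ENNReal.ofReal √(F.density θ (y, x)) ≤ C := by
  choose C hC hle using fun t : Fin T =>
    exists_lintegral_sqrt_normalMixturePDF_le K (S.scale_pos θ hθ t)
  refine ⟨∏ t, C t, ENNReal.prod_ne_top fun t _ => hC t, fun x => ?_⟩
  have hs : ∀ y : Fin T → ℝ, ENNReal.ofReal √(F.density θ (y, x)) = ∏ t,
      ENNReal.ofReal √(normalMixturePDF (S.prob θ) (S.loc θ (y, x) t) (θ (S.scale t)) (y t)) :=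
    fun y => by
      rw [S.density_eq, Real.sqrt_prod _ fun t _ => normalMixturePDF_nonneg (S.prob_nonneg θ hθ) _,
        ENNReal.ofReal_prod_of_nonneg fun t _ => Real.sqrt_nonneg _]
  simp_rw [hs]
  exact S.lintegral_prod_normalMixturePDF_le hθ (fun r => ENNReal.ofReal √r) (by fun_prop) C
    (fun t m => hle t _ m (S.prob_nonneg θ hθ) (S.sum_prob θ)) x

end SequentialForm

/-! ### Mixtures of panel densities -/

section Mixture

variable {T q K M : ℕ} {F : ComponentFamily T q} {ϑ : Param F M}

theorem sum_weight (hM : 1 ≤ M) (ϑ : Param F M) : ∑ j, weight ϑ j = 1 := sum_fullWeights hM _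

theorem continuous_weight (j : Fin M) : Continuous fun ϑ : Param F M => weight ϑ j :=
  (continuous_fullWeights j).comp (by fun_prop)

theorem continuous_comp (j : Fin M) : Continuous fun ϑ : Param F M => comp ϑ j := by
  unfold comp
  fun_prop

theorem weight_le_one (hM : 1 ≤ M) (hϑ : ϑ ∈ naturalSpace F M) (j : Fin M) : weight ϑ j ≤ 1 :=
  sum_weight hM ϑ ▸ Finset.single_le_sum (fun k _ => hϑ.1 k) (Finset.mem_univ j)

theorem mixDensity_pos (S : SequentialForm F K) (hM : 1 ≤ M) (hϑ : ϑ ∈ naturalSpace F M)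
    (w : Obs T q) : 0 < mixDensity ϑ w := by
  obtain ⟨j, -, hj⟩ : ∃ j ∈ Finset.univ, 0 < weight ϑ j := by
    by_contra! h
    linarith [Finset.sum_nonpos h, sum_weight hM ϑ]
  exact Finset.sum_pos' (fun j _ => mul_nonneg (hϑ.1 j) (S.density_pos (hϑ.2 j) w).le)
    ⟨j, Finset.mem_univ _, mul_pos hj (S.density_pos (hϑ.2 j) w)⟩

theorem mixDensity_le (hM : 1 ≤ M) (hϑ : ϑ ∈ naturalSpace F M) {C : ℝ} {w : Obs T q}
    (hC : ∀ j, F.density (comp ϑ j) w ≤ C) : mixDensity ϑ w ≤ C := by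
  refine (Finset.sum_le_sum fun j _ => mul_le_mul_of_nonneg_left (hC j) (hϑ.1 j)).trans_eq ?_
  rw [← Finset.sum_mul, sum_weight hM, one_mul]

theorem continuous_mixDensity (S : SequentialForm F K) (hϑ : ϑ ∈ naturalSpace F M) :
    Continuous (mixDensity ϑ) :=
  continuous_finsetSum _ fun j _ => (S.continuous_density (hϑ.2 j)).const_mul _

theorem continuousOn_mixDensity (S : SequentialForm F K) (w : Obs T q) :
    ContinuousOn (fun ϑ : Param F M => mixDensity ϑ w) (naturalSpace F M) :=
  continuousOn_finsetSum _ fun j _ => (continuous_weight j).continuousOn.mul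
    (S.continuousOn_density.comp (f := fun ϑ : Param F M => (comp ϑ j, w))
      ((continuous_comp j).prodMk continuous_const).continuousOn fun _ hϑ => ⟨hϑ.2 j, trivial⟩)

theorem lintegral_mixDensity_le_one (S : SequentialForm F K) (hM : 1 ≤ M)
    (hϑ : ϑ ∈ naturalSpace F M) (ν : Measure (Fin T → Fin q → ℝ)) [IsProbabilityMeasure ν] :
    ∫⁻ w, ENNReal.ofReal (mixDensity ϑ w) ∂(volume : Measure (Fin T → ℝ)).prod ν ≤ 1 := by
  have hmeas := (continuous_mixDensity S hϑ).measurable.ennreal_ofReal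
  rw [lintegral_prod_symm' _ hmeas]
  have hx : ∀ x, ∫⁻ y, ENNReal.ofReal (mixDensity ϑ (y, x)) ≤ 1 := fun x => by
    have hm : ∀ j, Measurable fun y : Fin T → ℝ => ENNReal.ofReal (F.density (comp ϑ j) (y, x)) :=
      fun j => ((S.continuous_density (hϑ.2 j)).comp (by fun_prop)).measurable.ennreal_ofReal
    unfold mixDensity
    simp_rw [ENNReal.ofReal_sum_of_nonneg fun j _ =>
      mul_nonneg (hϑ.1 j) (S.density_pos (hϑ.2 j) _).le, ENNReal.ofReal_mul (hϑ.1 _)]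
    rw [lintegral_finsetSum _ fun j _ => (hm j).const_mul _]
    simp_rw [lintegral_const_mul' _ _ ENNReal.ofReal_ne_top]
    calc _ ≤ ∑ j, ENNReal.ofReal (weight ϑ j) * 1 := by
          gcongr with j
          exact S.lintegral_density_le_one (hϑ.2 j) x
      _ = 1 := by
          simp_rw [mul_one]
          rw [← ENNReal.ofReal_sum_of_nonneg fun j _ => hϑ.1 j, sum_weight hM, ENNReal.ofReal_one]
  exact (lintegral_mono hx).trans_eq (by simp)

theorem lintegral_sqrt_mixDensity_lt_top (S : SequentialForm F K) (hM : 1 ≤ M)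
    (hϑ : ϑ ∈ naturalSpace F M) (ν : Measure (Fin T → Fin q → ℝ)) [IsProbabilityMeasure ν] :
    ∫⁻ w, ENNReal.ofReal √(mixDensity ϑ w) ∂(volume : Measure (Fin T → ℝ)).prod ν < ⊤ := by
  have hmeas := (continuous_mixDensity S hϑ).sqrt.measurable.ennreal_ofReal
  choose C hC hle using fun j => S.exists_lintegral_sqrt_density_le (hϑ.2 j)
  rw [lintegral_prod_symm' _ hmeas]
  have hx : ∀ x, ∫⁻ y, ENNReal.ofReal √(mixDensity ϑ (y, x)) ≤ ∑ j, C j := fun x => by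
    have hm : ∀ j, Measurable fun y : Fin T → ℝ => ENNReal.ofReal √(F.density (comp ϑ j) (y, x)) :=
      fun j => ((S.continuous_density (hϑ.2 j)).comp (by fun_prop)).sqrt.measurable.ennreal_ofReal
    have hs : ∀ y : Fin T → ℝ, ENNReal.ofReal √(mixDensity ϑ (y, x)) ≤
        ∑ j, ENNReal.ofReal √(F.density (comp ϑ j) (y, x)) := fun y => by
      rw [← ENNReal.ofReal_sum_of_nonneg fun j _ => Real.sqrt_nonneg _]
      have hd : ∀ j, 0 ≤ F.density (comp ϑ j) (y, x) := fun j => (S.density_pos (hϑ.2 j) _).le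
      exact ENNReal.ofReal_le_ofReal ((sqrt_sum_le_sum_sqrt _ fun j _ =>
        mul_nonneg (hϑ.1 j) (hd j)).trans (Finset.sum_le_sum fun j _ =>
          Real.sqrt_le_sqrt (mul_le_of_le_one_left (hd j) (weight_le_one hM hϑ j))))
    refine (lintegral_mono hs).trans ?_
    rw [lintegral_finsetSum _ fun j _ => hm j]
    exact Finset.sum_le_sum fun j _ => hle j x
  refine (lintegral_mono hx).trans_lt ?_
  rw [lintegral_const, measure_univ, mul_one]
  exact ENNReal.sum_lt_top.2 fun j _ => (hC j).lt_top

/-- On the restricted parameter space the error variances are at least `c₂ c₃`, so the mixture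
densities are uniformly bounded. -/
theorem mixDensity_le_of_mem_restrictedSpace (S : SequentialForm F K) (hM : 1 ≤ M)
    {Θ : Set (Param F M)} (hΘ : Θ ⊆ naturalSpace F M) {c₁ c₂ c₃ : ℝ} (hc₂ : 0 < c₂) (hc₃ : 0 < c₃)
    (hϑ : ϑ ∈ restrictedSpace Θ c₁ c₂ c₃) (w : Obs T q) :
    mixDensity ϑ w ≤ ((√(2 * Real.pi * (c₂ * c₃)))⁻¹) ^ T :=
  mixDensity_le hM (hΘ hϑ.1) fun j =>
    S.density_le ((hΘ hϑ.1).2 j) (mul_pos hc₂ hc₃) (fun v hv =>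
      (mul_le_mul_of_nonneg_left (hϑ.2.2.2 v hv).2 hc₂.le).trans ((hϑ.2.2.2 v hv).1 j)) w

end Mixture

end PanelMixture

end

/-! ### Consistency of the maximum likelihood estimator -/

theorem mainTheorem7
    -- the model: kind of panel, number of error components, panel length, number of covariates
    (kind : PanelMixture.PanelKind) (K T q : ℕ) (hK : 1 ≤ K) (hT : 2 ≤ T)
    -- the true parameter with `M₀` components
    (M₀ : ℕ) (hM₀ : 1 ≤ M₀)
    (ϑstar : PanelMixture.Param (kind.family K T q) M₀)
    (hstar : ϑstar ∈ PanelMixture.naturalSpace (kind.family K T q) M₀)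
    (hsep : ∀ j, (kind.family K T q).errorsSeparated (PanelMixture.comp ϑstar j))
    -- the law of the covariates
    (ν : Measure (Fin T → Fin q → ℝ)) [IsProbabilityMeasure ν]
    (hmom : ∀ t l, Integrable (fun x : Fin T → Fin q → ℝ => x t l ^ 2) ν)
    (hvary : ∀ (j : Fin M₀) (β : Fin q → ℝ),
      β ≠ (kind.family K T q).slope (PanelMixture.comp ϑstar j) →
      0 < ν {x | ∃ t, ∑ l, x t l * β l ≠
        ∑ l, x t l * (kind.family K T q).slope (PanelMixture.comp ϑstar j) l})
    -- the random sample
    {Ω : Type*} [MeasurableSpace Ω] (P : Measure Ω) [IsProbabilityMeasure P]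
    (W : ℕ → Ω → PanelMixture.Obs T q) (hW : ∀ i, Measurable (W i))
    (hindep : iIndepFun W P)
    (hlaw : ∀ i, P.map (W i) = PanelMixture.dataLaw ν ϑstar)
    -- the over-specified model and its restricted parameter space
    (M : ℕ) (hM : M₀ < M)
    (Θ : Set (PanelMixture.Param (kind.family K T q) M))
    (hΘ : Θ ⊆ PanelMixture.naturalSpace (kind.family K T q) M)
    (c₁ c₂ c₃ : ℝ) (hc₁ : 0 < c₁) (hc₂ : 0 < c₂) (hc₃ : 0 < c₃)
    (hne : (PanelMixture.reproducing Θ (PanelMixture.mixDensity ϑstar)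
        (PanelMixture.dataLaw ν ϑstar).support ∩
      PanelMixture.restrictedSpace Θ c₁ c₂ c₃).Nonempty)
    (hcompact : IsCompact (PanelMixture.restrictedSpace Θ c₁ c₂ c₃))
    -- the maximum likelihood estimator
    (ϑhat : ℕ → Ω → PanelMixture.Param (kind.family K T q) M)
    (hMLE : ∀ n, 1 ≤ n → ∀ᵐ ω ∂P,
      PanelMixture.IsMLE (PanelMixture.restrictedSpace Θ c₁ c₂ c₃) n (fun i => W i ω)
        (ϑhat n ω)) :
    ∀ᵐ ω ∂P, Tendsto (fun n => Metric.infDist (ϑhat n ω)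
      (PanelMixture.reproducing Θ (PanelMixture.mixDensity ϑstar)
        (PanelMixture.dataLaw ν ϑstar).support)) atTop (𝓝 0) := by
  have hM₁ : 1 ≤ M := by omega
  let S := kind.form hK T q
  set Λ := PanelMixture.restrictedSpace Θ c₁ c₂ c₃
  set R := PanelMixture.reproducing Θ (PanelMixture.mixDensity ϑstar)
    (PanelMixture.dataLaw ν ϑstar).support with hR
  obtain ⟨ϑ₀, hϑ₀R, hϑ₀Λ⟩ := hne
  have hΛ : Λ ⊆ PanelMixture.naturalSpace (kind.family K T q) M := fun ϑ hϑ => hΘ hϑ.1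
  have hstarc := PanelMixture.continuous_mixDensity S hstar
  have hsupp : ∀ᵐ ω ∂P, ∀ i, W i ω ∈ (PanelMixture.dataLaw ν ϑstar).support := by
    refine ae_all_iff.2 fun i => ae_of_ae_map (hW i).aemeasurable ?_
    rw [hlaw i]
    exact Measure.support_mem_ae
  -- outside the `1 / (m + 1)`-neighbourhood of `R`, no parameter beats the truth eventually
  have hfar : ∀ᵐ ω ∂P, ∀ m : ℕ, ∀ᶠ n : ℕ in atTop,
      ∀ ϑ ∈ Λ ∩ {ϑ | 1 / ((m : ℝ) + 1) ≤ Metric.infDist ϑ R},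
        PanelMixture.logLik n (fun i => W i ω) ϑ <
          PanelMixture.logLik n (fun i => W i ω) ϑstar := by
    refine ae_all_iff.2 fun m => ?_
    refine PanelMixture.ae_eventually_forall_sum_log_lt hstarc.measurable
      (PanelMixture.mixDensity_pos S hM₀ hstar)
      (PanelMixture.lintegral_sqrt_mixDensity_lt_top S hM₀ hstar ν) hW hindep hlaw
      (hcompact.inter_right (isClosed_le continuous_const (Metric.continuous_infDist_pt R)))
      (fun ϑ hϑ => (PanelMixture.continuous_mixDensity S (hΛ hϑ.1)).measurable)
      (fun w => (PanelMixture.continuousOn_mixDensity S w).mono fun ϑ hϑ => hΛ hϑ.1)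
      (fun ϑ hϑ => PanelMixture.mixDensity_pos S hM₁ (hΛ hϑ.1))
      (fun ϑ hϑ => PanelMixture.mixDensity_le_of_mem_restrictedSpace S hM₁ hΘ hc₂ hc₃ hϑ.1)
      (fun ϑ hϑ => PanelMixture.lintegral_mixDensity_le_one S hM₁ (hΛ hϑ.1) ν) ?_
    -- by continuity, almost sure equality of the densities is equality on the support
    intro ϑ hϑ heq
    have hϑR : ϑ ∈ R := ⟨hϑ.1.1, fun w hw => Measure.support_subset_of_isClosed
      (isClosed_eq (PanelMixture.continuous_mixDensity S (hΛ hϑ.1)) hstarc) heq hw⟩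
    have h1 : 1 / ((m : ℝ) + 1) ≤ Metric.infDist ϑ R := hϑ.2
    rw [Metric.infDist_zero_of_mem hϑR] at h1
    exact absurd h1 (not_le.2 (by positivity))
  have hMLE' : ∀ᵐ ω ∂P, ∀ n, 1 ≤ n → PanelMixture.IsMLE Λ n (fun i => W i ω) (ϑhat n ω) :=
    ae_all_iff.2 fun n => by
      by_cases hn : 1 ≤ n
      · filter_upwards [hMLE n hn] with ω hω _ using hω
      · exact Eventually.of_forall fun ω h => absurd h hn
  filter_upwards [hsupp, hfar, hMLE'] with ω hω hfarω hmle
  -- `ϑ₀` has the likelihood of the truth, so the maximizer does at least as well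
  have hϑ₀ : ∀ n, PanelMixture.logLik n (fun i => W i ω) ϑ₀ =
      PanelMixture.logLik n (fun i => W i ω) ϑstar := fun n =>
    Finset.sum_congr rfl fun i _ => by rw [hϑ₀R.2 _ (hω i)]
  rw [Metric.tendsto_atTop']
  intro ε hε
  obtain ⟨m, hm⟩ := exists_nat_one_div_lt hε
  obtain ⟨N, hN⟩ := eventually_atTop.1 (hfarω m)
  refine ⟨N, fun n hn => ?_⟩
  have hmax := hmle n (by omega)
  rw [Real.dist_0_eq_abs, abs_of_nonneg Metric.infDist_nonneg]
  by_contra! hge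
  have hlt := hN n hn.le _ ⟨hmax.1, hm.le.trans hge⟩
  exact absurd (hmax.2 hϑ₀Λ) (not_le.2 ((hϑ₀ n).symm ▸ hlt))
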